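/- A \emph{distance monoid} is a structure $(R,\oplus,\leq,0)$ such that $(R,\oplus,0)$ is a commutative monoid, $\leq$ is a total order on $R$, $r\leq r\oplus s$ for all $r,s\in R$, and $r\oplus s\leq t\oplus u$ whenever $r\leq t$ and $s\leq u$. Its \emph{Archimedean complexity} $\mathrm{arch}(R)$ is the least $m\in\mathbb{N}$ such that $r_0\oplus r_1\oplus\cdots\oplus r_m=r_1\oplus\cdots\oplus r_m$ for all $r_0\leq r_1\leq\cdots\leq r_m$ in $R$ (the empty sum being $0$), and $\mathrm{arch}(R)=\omega$ if there is no such $m$. Let $DM(n,m)$ denote the number of distance monoids, up to isomorphism (bijections preserving $\oplus$, $\leq$ and $0$), with exactly $n$ non-zero elements and Archimedean complexity $m$. Then for every fixed $k\in\mathbb{N}$ (including $k=0$) there exist constants $C_1(k)>0$ and $C_2(k)>0$, depending only on $k$, such that for all sufficiently large $n$, \[C_1(k)\leq\frac{DM(n,n-k)}{n^k}\leq C_2(k).\] -/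

import Mathlib

/-- A distance monoid: a commutative monoid `(R, +, 0)` with a total order such that
`r ≤ r + s`, and such that addition is monotone in both arguments. -/
class DistanceMonoid (R : Type*) extends AddCommMonoid R, LinearOrder R where
  protected le_add : ∀ r s : R, r ≤ r + s
  protected add_mono : ∀ r s t u : R, r ≤ t → s ≤ u → r + s ≤ t + u

instance DistanceMonoid.isOrderedAddMonoid (R : Type*) [DistanceMonoid R] :
    IsOrderedAddMonoid R where
  add_le_add_left a b h c := DistanceMonoid.add_mono a c b c h le_rfl

/-- The defining property of the Archimedean complexity:
`r₀ + r₁ + ⋯ + rₙ = r₁ + ⋯ + rₙ` whenever `r₀ ≤ r₁ ≤ ⋯ ≤ rₙ` in `R`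
(for `n = 0` the right-hand side is the empty sum `0`). -/
def ArchBoundedBy (R : Type*) [DistanceMonoid R] (n : ℕ) : Prop :=
  ∀ r : Fin (n + 1) → R, Monotone r → ∑ i, r i = ∑ i : Fin n, r i.succ

/-- The Archimedean complexity of `R`: the least `n` with `ArchBoundedBy R n`, and `⊤` (that is,
`ω`) if there is none. -/
noncomputable def arch (R : Type*) [DistanceMonoid R] : ℕ∞ :=
  sInf {m : ℕ∞ | ∃ n : ℕ, m = n ∧ ArchBoundedBy R n}

/-- Distance monoids with exactly `n` non-zero elements and Archimedean complexity `k`. -/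
structure FiniteDistanceMonoid (n k : ℕ) : Type 1 where
  carrier : Type
  [inst : DistanceMonoid carrier]
  encard_nonzero : {r : carrier | r ≠ 0}.encard = n
  arch_eq : arch carrier = k

attribute [instance] FiniteDistanceMonoid.inst

/-- Two distance monoids are identified when there is a bijection between them that preserves
addition and order (hence also `0`). -/
instance FiniteDistanceMonoid.isoSetoid (n k : ℕ) : Setoid (FiniteDistanceMonoid n k) where
  r A B := Nonempty (A.carrier ≃+o B.carrier)
  iseqv :=
    { refl := fun A => ⟨OrderAddMonoidIso.refl A.carrier⟩
      symm := fun ⟨e⟩ => ⟨e.symm⟩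
      trans := fun ⟨e⟩ ⟨f⟩ => ⟨e.trans f⟩ }

/-- `DM n k`: the number of distance monoids, up to isomorphism, with `n` non-zero elements and
Archimedean complexity `k`. -/
noncomputable def DM (n k : ℕ) : ℕ :=
  Nat.card (Quotient (FiniteDistanceMonoid.isoSetoid n k))

/-! Write `n = m + k`. For the lower bound, start from truncated addition on `{0, …, m}` and insert
one extra element just above each `j` in a `k`-subset `S` of the open interval `(0, m)`, letting
sums of non-zero elements see only integral parts. This leaves the complexity equal to `m`, and `S`
can be read off from the order and the multiples of the least non-zero element, so there are at
least `(m - 1).choose k` classes.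

For the upper bound, put `m = M + 1`. Failure of `ArchBoundedBy R M` gives a strict chain of `M + 2`
partial sums, leaving only `k` further elements. For large `M`, pigeonhole on these `k` elements
shows that the smallest summand `a` already has `M + 2` distinct multiples (`exists_nsmul_add_ne`),
so all but `k` elements are multiples of `a`.

Number the elements in order. The positions of the `k` exceptional elements can be chosen in at most
`(n + 1) ^ k` ways. Given them, translation by `a` is the successor map outside `2 * k + 1` points
and moves points by a bounded amount. Given the translation, addition is determined by its values on
at most `(k + 1) ^ 2` pairs, each value lying in a bounded window. Both of these counts depend only
on `k`. -/

/-! ### Lower bound: truncated addition with inserted elements. -/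

/-- The elements of the distance monoid obtained from the truncated addition on `{0, …, m}`, where
`j` is represented by `2 * j`, by inserting a new element `2 * j + 1` right above each positive
`j ∈ S`. -/
structure FloorMonoid (m : ℕ) (S : Finset ℕ) : Type where
  /-- Twice the integral part, plus one for the inserted elements. -/
  val : ℕ
  val_le : val ≤ 2 * m
  parity : val % 2 = 0 ∨ 0 < val / 2 ∧ val / 2 ∈ S

namespace FloorMonoid

variable {m : ℕ} {S : Finset ℕ}

theorem val_injective : Function.Injective (val : FloorMonoid m S → ℕ) := by
  rintro ⟨x, _, _⟩ ⟨y, _, _⟩ h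
  cases h
  rfl

theorem ext' {x y : FloorMonoid m S} (h : x.val = y.val) : x = y := val_injective h

instance : LinearOrder (FloorMonoid m S) := LinearOrder.lift' val val_injective

instance : Zero (FloorMonoid m S) := ⟨⟨0, by simp, by simp⟩⟩

/-- The sum of two non-zero elements is the truncated sum of their integral parts. -/
instance : Add (FloorMonoid m S) :=
  ⟨fun x y => if x.val = 0 then y else if y.val = 0 then x else
    ⟨2 * min (x.val / 2 + y.val / 2) m, by omega, by omega⟩⟩

theorem val_zero : (0 : FloorMonoid m S).val = 0 := rfl

theorem val_add (x y : FloorMonoid m S) :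
    (x + y).val = if x.val = 0 then y.val else if y.val = 0 then x.val else
      2 * min (x.val / 2 + y.val / 2) m := by
  change (ite _ _ _ : FloorMonoid m S).val = _
  rw [apply_ite val, apply_ite val]

theorem le_iff {x y : FloorMonoid m S} : x ≤ y ↔ x.val ≤ y.val := Iff.rfl

theorem lt_iff {x y : FloorMonoid m S} : x < y ↔ x.val < y.val := Iff.rfl

theorem val_ne_one (x : FloorMonoid m S) : x.val ≠ 1 := by
  have := x.parity
  omega

instance : DistanceMonoid (FloorMonoid m S) where
  add_assoc x y z := by
    apply ext'
    have := val_ne_one x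
    have := val_ne_one y
    have := val_ne_one z
    have := val_le x
    simp only [val_add]
    split_ifs <;> omega
  zero_add x := ext' (by simp [val_add, val_zero])
  add_zero x := ext' (by simp +contextual [val_add, val_zero])
  add_comm x y := by
    apply ext'
    simp only [val_add]
    split_ifs <;> omega
  nsmul := nsmulRec
  __ := (inferInstance : LinearOrder (FloorMonoid m S))
  le_add x y := by
    have := val_ne_one y
    have := val_le x
    rw [le_iff, val_add]
    split_ifs <;> omega
  add_mono x y z w hxz hyw := by
    rw [le_iff] at *
    have := val_ne_one z
    have := val_ne_one w
    have := val_le x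
    have := val_le y
    simp only [val_add]
    split_ifs <;> omega

/-- The least non-zero element, for `0 < m`. -/
def one (m : ℕ) (S : Finset ℕ) : FloorMonoid m S := ⟨2 * min 1 m, by omega, by omega⟩

theorem val_nsmul_one (hm : 0 < m) (j : ℕ) (hj : j ≤ m) : (j • one m S).val = 2 * j := by
  induction j with
  | zero => simp [val_zero]
  | succ j ih =>
    have h1 : (one m S).val = 2 := by
      change 2 * min 1 m = 2
      omega
    rw [succ_nsmul, val_add, ih (by omega), h1]
    rcases Nat.eq_zero_or_pos j with rfl | hj0
    · simp
    · rw [if_neg (by omega), if_neg (by omega)]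
      omega

/-- Every non-zero element has integral part at least one, because the value `1` is excluded. Hence
`m` non-zero summands already reach the cap, which is what bounds the complexity. -/
theorem min_card_le_val_sum {ι : Type*} (s : Finset ι) (r : ι → FloorMonoid m S)
    (hr : ∀ i ∈ s, r i ≠ 0) : min s.card m ≤ (∑ i ∈ s, r i).val / 2 := by
  classical
  induction s using Finset.induction_on with
  | empty => simp
  | insert i s hi ih =>
    have hri : (r i).val ≠ 0 := fun h => hr i (by simp) (ext' h)
    have := val_ne_one (r i)
    have := val_le (r i)
    have := ih fun j hj => hr j (by simp [hj])
    rw [Finset.sum_insert hi, Finset.card_insert_of_notMem hi, val_add]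
    split_ifs <;> omega

theorem archBoundedBy : ArchBoundedBy (FloorMonoid m S) m := by
  intro r hr
  rw [Fin.sum_univ_succ]
  by_cases h0 : r 0 = 0
  · rw [h0, zero_add]
  have hne : ∀ i, r i ≠ 0 := fun i hi => h0 <| by
    have := hr (Fin.zero_le i)
    rw [hi, le_iff, val_zero] at this
    exact ext' (by rw [val_zero]; omega)
  have h := min_card_le_val_sum Finset.univ (fun i : Fin m => r i.succ) (fun i _ => hne _)
  rw [Finset.card_univ, Fintype.card_fin, min_self] at h
  apply ext'
  have h1 := val_le (r 0 + ∑ i : Fin m, r i.succ)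
  have h2 : (∑ i : Fin m, r i.succ).val ≤ (r 0 + ∑ i : Fin m, r i.succ).val := by
    rw [add_comm]
    exact le_iff.1 (DistanceMonoid.le_add _ _)
  omega

theorem not_archBoundedBy (hm : 0 < m) {j : ℕ} (hj : j < m) :
    ¬ ArchBoundedBy (FloorMonoid m S) j := by
  intro h
  have h1 := h (fun _ => one m S) (fun _ _ _ => le_rfl)
  simp only [Finset.sum_const, Finset.card_univ, Fintype.card_fin] at h1
  have h2 := congrArg val h1
  rw [val_nsmul_one hm _ hj, val_nsmul_one hm _ hj.le] at h2
  omega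

theorem arch_eq (hm : 0 < m) : arch (FloorMonoid m S) = m := by
  apply le_antisymm
  · exact sInf_le ⟨m, rfl, archBoundedBy⟩
  · refine le_sInf ?_
    rintro _ ⟨j, rfl, hj⟩
    by_contra! hlt
    exact not_archBoundedBy hm (by exact_mod_cast hlt) hj

theorem encard_nonzero (hS : S ⊆ Finset.Ioo 0 m) :
    {r : FloorMonoid m S | r ≠ 0}.encard = (m + S.card : ℕ) := by
  have hval : Function.Injective (val : FloorMonoid m S → ℕ) := val_injective
  rw [← hval.encard_image {r : FloorMonoid m S | r ≠ 0}]
  have himage : val '' {r : FloorMonoid m S | r ≠ 0} =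
      (((Finset.range m).image (fun j => 2 * j + 2) ∪ S.image (fun j => 2 * j + 1) :
        Finset ℕ) : Set ℕ) := by
    ext x
    simp only [Set.mem_image, Set.mem_ofPred_eq, Finset.coe_union, Finset.coe_image, Set.mem_union,
      Finset.mem_coe, Finset.mem_range]
    constructor
    · rintro ⟨y, hy, rfl⟩
      have hy0 : y.val ≠ 0 := fun h => hy (ext' h)
      have hle := val_le y
      rcases y.parity with h | h
      · exact Or.inl ⟨y.val / 2 - 1, by omega, by omega⟩
      · by_cases h' : y.val % 2 = 0
        · exact Or.inl ⟨y.val / 2 - 1, by omega, by omega⟩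
        · exact Or.inr ⟨y.val / 2, h.2, by omega⟩
    · rintro (⟨j, hj, rfl⟩ | ⟨j, hj, rfl⟩)
      · exact ⟨⟨2 * j + 2, by omega, by omega⟩, fun h =>
          absurd (congrArg val h) (by simp [val_zero]), rfl⟩
      · have hj' := Finset.mem_Ioo.1 (hS hj)
        have h2 : (2 * j + 1) / 2 = j := by omega
        exact ⟨⟨2 * j + 1, by omega, Or.inr ⟨by omega, by rwa [h2]⟩⟩, fun h =>
          absurd (congrArg val h) (by simp [val_zero]), rfl⟩
  rw [himage, Set.encard_coe_eq_coe_finsetCard, Finset.card_union_of_disjoint,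
    Finset.card_image_of_injective _ fun a b h => by simpa using h,
    Finset.card_image_of_injective _ fun a b h => by simpa using h, Finset.card_range]
  rw [Finset.disjoint_left]
  intro x hx hx'
  obtain ⟨i, -, rfl⟩ := Finset.mem_image.1 hx
  obtain ⟨j, -, h⟩ := Finset.mem_image.1 hx'
  omega

/-- Describes `S` by order and multiples of `one` alone, hence in terms invariant under isomorphism.
-/
theorem mem_iff_exists_between {j : ℕ} (hj : j ∈ Finset.Ioo 0 m) :
    j ∈ S ↔ ∃ x : FloorMonoid m S, j • one m S < x ∧ x < (j + 1) • one m S := by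
  obtain ⟨h0, hjm⟩ := Finset.mem_Ioo.1 hj
  have e1 : (j • one m S).val = 2 * j := val_nsmul_one (by omega) _ hjm.le
  have e2 : ((j + 1) • one m S).val = 2 * (j + 1) := val_nsmul_one (by omega) _ hjm
  simp only [lt_iff, e1, e2]
  constructor
  · intro h
    have h2 : (2 * j + 1) / 2 = j := by omega
    refine ⟨⟨2 * j + 1, by omega, Or.inr ⟨by omega, by rwa [h2]⟩⟩, ?_, ?_⟩
    · change 2 * j < 2 * j + 1
      omega
    · change 2 * j + 1 < 2 * (j + 1)
      omega
  · rintro ⟨x, hx1, hx2⟩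
    have hx := x.parity
    have h2 : x.val / 2 = j := by omega
    rw [h2] at hx
    rcases hx with hx | hx
    · omega
    · exact hx.2

theorem map_one {S' : Finset ℕ} (hm : 0 < m) (e : FloorMonoid m S ≃+o FloorMonoid m S') :
    e (one m S) = one m S' := by
  have h1 : ∀ S : Finset ℕ, (one m S).val = 2 := fun S => by
    change 2 * min 1 m = 2
    omega
  have key : ∀ (S : Finset ℕ) (x : FloorMonoid m S), x ≠ 0 → one m S ≤ x := fun S x hx => by
    have := val_ne_one x
    have hx0 : x.val ≠ 0 := fun h => hx (ext' h)
    rw [le_iff, h1]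
    omega
  have hne : ∀ S : Finset ℕ, one m S ≠ 0 := fun S h => by
    have := congrArg val h
    rw [h1, val_zero] at this
    omega
  have h0 : e 0 = 0 := _root_.map_zero e.toAddEquiv
  apply le_antisymm
  · rw [← e.apply_symm_apply (one m S')]
    refine e.toOrderIso.monotone (key _ _ fun h => hne S' ?_)
    rw [← e.apply_symm_apply (one m S'), h, h0]
  · exact key _ _ fun h => hne S (e.injective (h.trans h0.symm))

theorem eq_of_orderAddMonoidIso {S' : Finset ℕ} (hS : S ⊆ Finset.Ioo 0 m)
    (hS' : S' ⊆ Finset.Ioo 0 m) (e : FloorMonoid m S ≃+o FloorMonoid m S') : S = S' := by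
  ext j
  by_cases hj : j ∈ Finset.Ioo 0 m
  · rw [mem_iff_exists_between hj, mem_iff_exists_between hj]
    have hm : 0 < m := by
      have := Finset.mem_Ioo.1 hj
      omega
    have hsmul : ∀ i : ℕ, e (i • one m S) = i • one m S' := fun i => by
      rw [← map_one hm e]
      exact map_nsmul e.toAddEquiv i _
    rw [← hsmul, ← hsmul]
    constructor
    · rintro ⟨x, h1, h2⟩
      exact ⟨e x, e.toOrderIso.strictMono h1, e.toOrderIso.strictMono h2⟩
    · rintro ⟨x, h1, h2⟩
      refine ⟨e.symm x, e.toOrderIso.lt_iff_lt.1 ?_, e.toOrderIso.lt_iff_lt.1 ?_⟩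
      · exact h1.trans_eq (e.apply_symm_apply x).symm
      · exact (e.apply_symm_apply x).trans_lt h2
  · exact iff_of_false (fun h => hj (hS h)) (fun h => hj (hS' h))

end FloorMonoid

/-- `FloorMonoid n S` as an object counted by `DM (n + k) n`. -/
def FiniteDistanceMonoid.ofFinset {k n : ℕ} (hn : 0 < n)
    (S : Finset.powersetCard k (Finset.Ioo 0 n)) : FiniteDistanceMonoid (n + k) n where
  carrier := FloorMonoid n S
  encard_nonzero := by
    rw [FloorMonoid.encard_nonzero (Finset.mem_powersetCard.1 S.2).1,
      (Finset.mem_powersetCard.1 S.2).2]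
  arch_eq := FloorMonoid.arch_eq hn

/-- Finiteness is needed because `Nat.card` of an infinite type is `0`; it comes from the upper
bound argument. -/
theorem choose_le_DM (k n : ℕ) (hn : 0 < n)
    [Finite (Quotient (FiniteDistanceMonoid.isoSetoid (n + k) n))] :
    (n - 1).choose k ≤ DM (n + k) n := by
  have hinj : Function.Injective fun S : Finset.powersetCard k (Finset.Ioo 0 n) =>
      (Quotient.mk _ (FiniteDistanceMonoid.ofFinset hn S) :
        Quotient (FiniteDistanceMonoid.isoSetoid (n + k) n)) := by
    intro S S' h
    obtain ⟨e⟩ := Quotient.exact h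
    exact Subtype.ext (FloorMonoid.eq_of_orderAddMonoidIso
      (Finset.mem_powersetCard.1 S.2).1 (Finset.mem_powersetCard.1 S'.2).1 e)
  have := Nat.card_le_card_of_injective _ hinj
  rwa [Nat.card_eq_fintype_card, Fintype.card_coe, Finset.card_powersetCard, Nat.card_Ioo] at this

/-! ### Structure: all but `k` elements are multiples of a single one. -/

namespace DistanceMonoid

variable {R : Type*} [DistanceMonoid R]

theorem zero_le' (x : R) : 0 ≤ x := by
  simpa using DistanceMonoid.le_add 0 x

theorem le_add' (x y : R) : y ≤ x + y := by
  simpa [add_comm] using DistanceMonoid.le_add y x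

theorem nsmul_mono (a : R) : Monotone fun j : ℕ => j • a :=
  monotone_nat_of_le_succ fun j => by
    rw [succ_nsmul]
    exact DistanceMonoid.le_add _ _

theorem add_nsmul_eq_self {x a : R} (h : x + a = x) (j : ℕ) : x + j • a = x := by
  induction j with
  | zero => simp
  | succ j ih => rw [succ_nsmul, ← add_assoc, ih, h]

section Chain

variable {b : ℕ → R} {a : R} {M : ℕ}

theorem sum_range_mono (b : ℕ → R) : Monotone fun j => ∑ i ∈ Finset.range j, b i :=
  monotone_nat_of_le_succ fun j => by
    rw [Finset.sum_range_succ]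
    exact DistanceMonoid.le_add _ _

/-- If a shorter partial sum absorbed `a`, adding the remaining terms would make the `M`-term sum
absorb it too. -/
theorem sum_range_lt_add
    (hne : ∑ i ∈ Finset.range M, b i + a ≠ ∑ i ∈ Finset.range M, b i) {j : ℕ} (hj : j ≤ M) :
    ∑ i ∈ Finset.range j, b i < ∑ i ∈ Finset.range j, b i + a := by
  refine lt_of_le_of_ne (DistanceMonoid.le_add _ _) fun h => hne ?_
  rw [← Finset.sum_range_add_sum_Ico b hj, add_right_comm, ← h]

theorem sum_range_add_nsmul_le (ha : ∀ i, a ≤ b i) (i j : ℕ) :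
    ∑ l ∈ Finset.range i, b l + j • a ≤ ∑ l ∈ Finset.range (i + j), b l := by
  induction j with
  | zero => simp
  | succ j ih =>
    rw [succ_nsmul, ← add_assoc, ← add_assoc, Finset.sum_range_succ]
    exact add_le_add ih (ha _)

theorem sum_range_lt_sum_range (ha : ∀ i, a ≤ b i)
    (hne : ∑ i ∈ Finset.range M, b i + a ≠ ∑ i ∈ Finset.range M, b i) {i j : ℕ} (hij : i < j)
    (hi : i ≤ M) : ∑ l ∈ Finset.range i, b l < ∑ l ∈ Finset.range j, b l :=
  (sum_range_lt_add hne hi).trans_le <| by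
    have := sum_range_add_nsmul_le ha i 1
    rw [one_nsmul] at this
    exact this.trans (sum_range_mono b hij)

/-- The elements that are not among the first `M + 2` terms of a strict chain of partial sums. -/
theorem card_compl_image_sum_range [Fintype R] {k : ℕ} (hcard : Fintype.card R = M + 2 + k)
    (ha : ∀ i, a ≤ b i)
    (hne : ∑ i ∈ Finset.range M, b i + a ≠ ∑ i ∈ Finset.range M, b i) :
    ((Finset.range (M + 2)).image fun j => ∑ l ∈ Finset.range j, b l)ᶜ.card = k := by
  rw [Finset.card_compl, Finset.card_image_of_injOn, Finset.card_range, hcard]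
  · omega
  · intro i hi j hj hij
    simp only [Finset.coe_range, Set.mem_Iio] at hi hj
    by_contra! h
    rcases h.lt_or_gt with h | h
    · exact (sum_range_lt_sum_range ha hne h (by omega)).ne hij
    · exact (sum_range_lt_sum_range ha hne h (by omega)).ne' hij

/-- Chain elements up to index `M` do not absorb `a`, and later ones lie strictly above the `j`-th.
-/
theorem mem_compl_image_sum_range [Fintype R] (ha : ∀ i, a ≤ b i)
    (hne : ∑ i ∈ Finset.range M, b i + a ≠ ∑ i ∈ Finset.range M, b i)
    {x : R} {j : ℕ} (hj : j ≤ M) (h1 : x + a = x) (h2 : x ≤ ∑ l ∈ Finset.range j, b l) :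
    x ∈ ((Finset.range (M + 2)).image fun j => ∑ l ∈ Finset.range j, b l)ᶜ := by
  simp only [Finset.mem_compl, Finset.mem_image, Finset.mem_range, not_exists, not_and]
  rintro l hl rfl
  by_cases hlM : l ≤ M
  · exact (sum_range_lt_add hne hlM).ne' h1
  · exact absurd (sum_range_lt_sum_range ha hne (by omega : j < l) hj) h2.not_gt

/-- If `k • a` absorbed `a`, so would its sum with each of the partial sums of length `i * (k + 1)`,
`i ≤ k`. The block length `k + 1` keeps these elements distinct, giving `k + 1` elements off the
chain, one too many. -/
theorem nsmul_ne_of_le [Fintype R] {k : ℕ} (hcard : Fintype.card R = M + 2 + k)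
    (hM : (k + 1) * (k + 1) ≤ M + 1) (ha : ∀ i, a ≤ b i)
    (hne : ∑ i ∈ Finset.range M, b i + a ≠ ∑ i ∈ Finset.range M, b i) :
    k • a + a ≠ k • a := by
  intro h
  have hlt : ∀ i ≤ k, i * (k + 1) + k ≤ M := fun i hi => by
    have := Nat.mul_le_mul_right (k + 1) hi
    rw [Nat.add_mul] at hM
    omega
  have hmaps : ∀ i ∈ Finset.range (k + 1),
      ∑ l ∈ Finset.range (i * (k + 1)), b l + k • a ∈
        ((Finset.range (M + 2)).image fun j => ∑ l ∈ Finset.range j, b l)ᶜ := fun i hi =>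
    mem_compl_image_sum_range ha hne (hlt i (by simpa [Nat.lt_succ_iff] using hi))
      (by rw [add_assoc, h]) (sum_range_add_nsmul_le ha _ _)
  have hstrict : ∀ i j, i ≤ k → i < j →
      ∑ l ∈ Finset.range (i * (k + 1)), b l + k • a <
        ∑ l ∈ Finset.range (j * (k + 1)), b l + k • a := fun i j hi hij =>
    calc _ ≤ ∑ l ∈ Finset.range (i * (k + 1) + k), b l := sum_range_add_nsmul_le ha _ _
      _ < ∑ l ∈ Finset.range (i * (k + 1) + k + 1), b l :=
        sum_range_lt_sum_range ha hne (Nat.lt_succ_self _) (hlt i hi)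
      _ ≤ ∑ l ∈ Finset.range (j * (k + 1)), b l := by
        apply sum_range_mono b
        have := Nat.mul_le_mul_right (k + 1) (Nat.succ_le_of_lt hij)
        rw [Nat.succ_mul] at this
        omega
      _ ≤ _ := DistanceMonoid.le_add _ _
  have := Finset.card_le_card_of_injOn _ hmaps (by
    intro i hi j hj hij
    simp only [Finset.coe_range, Set.mem_Iio] at hi hj
    by_contra! h
    rcases h.lt_or_gt with h | h
    · exact (hstrict i j (by omega) h).ne hij
    · exact (hstrict j i (by omega) h).ne' hij)
  rw [card_compl_image_sum_range hcard ha hne, Finset.card_range] at this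
  omega

theorem nsmul_lt_nsmul_of_add_ne {j : ℕ} {a : R} (h : j • a + a ≠ j • a) {i l : ℕ} (hi : i ≤ j)
    (hil : i < l) : i • a < l • a := by
  have h' : i • a < (i + 1) • a := by
    refine lt_of_le_of_ne (nsmul_mono a (Nat.le_succ i)) fun h' => h ?_
    rw [succ_nsmul] at h'
    rw [← Nat.sub_add_cancel hi, add_nsmul, add_assoc, ← h']
  exact h'.trans_le (nsmul_mono a hil)

/-- Otherwise `a, 2a, …, (k + 1)a` would be distinct and strictly between the first two chain
elements `0` and `b 0`, again `k + 1` elements off the chain. -/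
theorem le_succ_nsmul [Fintype R] {k : ℕ} (hcard : Fintype.card R = M + 2 + k)
    (hM : (k + 1) * (k + 1) ≤ M + 1) (ha : ∀ i, a ≤ b i)
    (hne : ∑ i ∈ Finset.range M, b i + a ≠ ∑ i ∈ Finset.range M, b i) :
    b 0 ≤ (k + 1) • a := by
  by_contra! hlt
  have hka := nsmul_ne_of_le hcard hM ha hne
  have hmaps : ∀ i ∈ Finset.range (k + 1), (i + 1) • a ∈
      ((Finset.range (M + 2)).image fun j => ∑ l ∈ Finset.range j, b l)ᶜ := by
    intro i hi
    rw [Finset.mem_range] at hi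
    simp only [Finset.mem_compl, Finset.mem_image, Finset.mem_range, not_exists, not_and]
    intro l hl h
    rcases Nat.eq_zero_or_pos l with rfl | hl0
    · have := nsmul_lt_nsmul_of_add_ne hka (Nat.zero_le k) (Nat.succ_pos i)
      rw [← h] at this
      simp at this
    · have h1 := sum_range_mono b (Nat.succ_le_of_lt hl0)
      have h2 := (nsmul_mono a (show i + 1 ≤ k + 1 by omega)).trans_lt hlt
      simp only [Nat.succ_eq_add_one, zero_add, Finset.sum_range_one] at h1
      exact (h2.trans_le h1).ne h.symm
  have := Finset.card_le_card_of_injOn _ hmaps (by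
    intro i hi j hj hij
    simp only [Finset.coe_range, Set.mem_Iio] at hi hj
    by_contra! h
    rcases h.lt_or_gt with h | h
    · exact (nsmul_lt_nsmul_of_add_ne hka (by omega) (Nat.succ_lt_succ h)).ne hij
    · exact (nsmul_lt_nsmul_of_add_ne hka (by omega) (Nat.succ_lt_succ h)).ne' hij)
  rw [card_compl_image_sum_range hcard ha hne, Finset.card_range] at this
  omega

/-- If `M • a` absorbs `a`, it absorbs every `b i ≤ (k + 1) • a`. Then the sum of `M + 1` terms is
at most `M • a`, hence at most the sum of `M` terms, contradicting strictness. -/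
theorem nsmul_add_ne [Fintype R] {k : ℕ} (hcard : Fintype.card R = M + 2 + k)
    (hM : (k + 1) * (k + 1) ≤ M + 1) (ha : ∀ i, a ≤ b i) (hb : ∀ i, b i ≤ b 0)
    (hne : ∑ i ∈ Finset.range M, b i + a ≠ ∑ i ∈ Finset.range M, b i) :
    M • a + a ≠ M • a := by
  intro h
  have h1 : ∀ i, M • a + b i = M • a := fun i => by
    apply le_antisymm _ (DistanceMonoid.le_add _ _)
    calc M • a + b i ≤ M • a + (k + 1) • a :=
          add_le_add le_rfl ((hb i).trans (le_succ_nsmul hcard hM ha hne))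
      _ = M • a := add_nsmul_eq_self h _
  have h2 : ∀ j, M • a + ∑ i ∈ Finset.range j, b i = M • a := fun j => by
    induction j with
    | zero => simp
    | succ j ih => rw [Finset.sum_range_succ, ← add_assoc, ih, h1]
  have h3 : ∑ i ∈ Finset.range (M + 1), b i ≤ M • a := (le_add' _ _).trans_eq (h2 _)
  have h4 : M • a ≤ ∑ i ∈ Finset.range M, b i := by
    simpa using sum_range_add_nsmul_le ha 0 M
  exact (h3.trans h4).not_gt (sum_range_lt_sum_range ha hne (Nat.lt_succ_self M) le_rfl)

end Chain

theorem exists_nsmul_add_ne [Fintype R] {k M : ℕ} (hcard : Fintype.card R = M + 2 + k)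
    (hM : (k + 1) * (k + 1) ≤ M + 1) (h : ¬ ArchBoundedBy R M) :
    ∃ a : R, M • a + a ≠ M • a := by
  simp only [ArchBoundedBy, not_forall] at h
  obtain ⟨r, hr, hne⟩ := h
  -- The clamped index extends `r` to all of `ℕ`. Reading it backwards puts the largest term first,
  -- and truncated subtraction makes `r' (M - i)` equal to `r 0` from `i = M` on.
  set r' : ℕ → R := fun i => r ⟨min i M, by omega⟩ with hr'
  have hmono : Monotone r' := fun i j hij => hr (by
    rw [Fin.mk_le_mk]
    omega)
  refine ⟨r 0, nsmul_add_ne (b := fun i => r' (M - i)) hcard hM (fun i => hr (Fin.zero_le _))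
    (fun i => hmono (by omega)) ?_⟩
  have hsum : ∑ i ∈ Finset.range M, r' (M - i) = ∑ i : Fin M, r i.succ := by
    have e1 : ∑ i ∈ Finset.range M, r' (M - i) = ∑ i ∈ Finset.range M, r' (M - 1 - i + 1) :=
      Finset.sum_congr rfl fun i hi => by
        rw [Finset.mem_range] at hi
        congr 1
        omega
    rw [e1, Finset.sum_range_reflect (fun i => r' (i + 1)) M,
      Finset.sum_range]
    refine Finset.sum_congr rfl fun i _ => congrArg r ?_
    ext
    simp only [Fin.val_succ]
    omega
  rw [hsum]
  rwa [Fin.sum_univ_succ, add_comm] at hne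

end DistanceMonoid

/-! ### Counting candidate operations on `Fin (n + 1)`. -/

section Counting

theorem card_piFinset_le_pow {α β : Type*} [Fintype α] [DecidableEq α] (s : α → Finset β)
    (B : Finset α) (c : ℕ) (hB : ∀ x ∈ B, (s x).card ≤ c) (hB' : ∀ x ∉ B, (s x).card ≤ 1) :
    (Fintype.piFinset s).card ≤ c ^ B.card := by
  rw [Fintype.card_piFinset]
  calc ∏ x, (s x).card ≤ ∏ x, (if x ∈ B then c else 1) :=
        Finset.prod_le_prod' fun x _ => by
          split_ifs with h
          · exact hB x h
          · exact hB' x h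
    _ = c ^ B.card := by simp [Finset.prod_ite_mem]

theorem card_filter_window_le {n : ℕ} (l d : ℕ) (s : Finset (Fin n))
    (hs : ∀ y ∈ s, l ≤ (y : ℕ) ∧ (y : ℕ) ≤ l + d) : s.card ≤ d + 1 := by
  have : (s.image Fin.val).card = s.card := Finset.card_image_of_injective _ Fin.val_injective
  rw [← this]
  calc _ ≤ (Finset.Icc l (l + d)).card := Finset.card_le_card fun x hx => by
        obtain ⟨y, hy, rfl⟩ := Finset.mem_image.1 hx
        exact Finset.mem_Icc.2 (hs y hy)
    _ = d + 1 := by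
        rw [Nat.card_Icc]
        omega

variable {n : ℕ}

open Classical in
/-- The maps that move every point up by at most `k + 2` and that are the successor map away
from `E`. -/
noncomputable def shiftMaps (k : ℕ) (E : Finset (Fin (n + 1))) :
    Finset (Fin (n + 1) → Fin (n + 1)) :=
  Fintype.piFinset fun x => {y | (x : ℕ) ≤ y ∧ (y : ℕ) ≤ x + (k + 2) ∧
    (x ∉ E → (x : ℕ) < n → (∀ z ∈ E, (z : ℕ) ≠ x + 1) → (y : ℕ) = x + 1)}

theorem card_shiftMaps_le {k : ℕ} {E : Finset (Fin (n + 1))} (hE : E.card = k) :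
    (shiftMaps k E).card ≤ (k + 3) ^ (2 * k + 1) := by
  classical
  -- The points where the successor rule may fail: the last point, `E`, and the predecessors of
  -- points of `E`.
  set B : Finset (Fin (n + 1)) :=
    insert (Fin.last n) (E ∪ (Finset.univ.filter fun x : Fin (n + 1) => ∃ z ∈ E, (z : ℕ) = x + 1)) with hB
  have hBcard : B.card ≤ 2 * k + 1 := by
    have h1 : (Finset.univ.filter fun x : Fin (n + 1) => ∃ z ∈ E, (z : ℕ) = x + 1).card ≤ E.card := by
      have hsub : (Finset.univ.filter fun x : Fin (n + 1) => ∃ z ∈ E, (z : ℕ) = x + 1).image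
          (fun x : Fin (n + 1) => (x : ℕ) + 1) ⊆ E.image Fin.val := by
        intro i hi
        obtain ⟨x, hx, rfl⟩ := Finset.mem_image.1 hi
        obtain ⟨z, hz, h⟩ := (Finset.mem_filter.1 hx).2
        exact Finset.mem_image.2 ⟨z, hz, h⟩
      have := Finset.card_le_card hsub
      rwa [Finset.card_image_of_injective _ Fin.val_injective, Finset.card_image_of_injective _
        (fun x y h => Fin.ext (by simpa using h))] at this
    refine (Finset.card_insert_le _ _).trans
      (Nat.succ_le_succ ((Finset.card_union_le _ _).trans ?_))
    omega
  refine (card_piFinset_le_pow _ B (k + 3) ?_ ?_).trans (Nat.pow_le_pow_right (by omega) hBcard)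
  · intro x _
    refine card_filter_window_le x (k + 2) _ fun y hy => ?_
    have := (Finset.mem_filter.1 hy).2
    exact ⟨this.1, this.2.1⟩
  · intro x hx
    simp only [hB, Finset.mem_insert, Finset.mem_union, Finset.mem_filter, Finset.mem_univ,
      true_and, not_or, not_exists, not_and] at hx
    have hxn : (x : ℕ) < n := by
      have := x.2
      have : (x : ℕ) ≠ n := fun h => hx.1 (Fin.ext h)
      omega
    refine card_filter_window_le (x + 1) 0 _ fun y hy => ?_
    have := (Finset.mem_filter.1 hy).2.2.2 hx.2.1 hxn hx.2.2
    omega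

/-- The greatest `i ≤ n` such that the `i`-th iterate of `τ` at `0` is at most `x`. -/
noncomputable def shiftFloor (τ : Fin (n + 1) → Fin (n + 1)) (x : Fin (n + 1)) : ℕ :=
  Nat.findGreatest (fun i => τ^[i] 0 ≤ x) n

open Classical in
/-- The points that are not images under `τ` of smaller points. -/
noncomputable def shiftGenerators (τ : Fin (n + 1) → Fin (n + 1)) : Finset (Fin (n + 1)) :=
  {x | ∀ y < x, τ y ≠ x}

open Classical in
/-- The commutative operations that commute with the shift `τ` and that are additive, up to an
error `k + 2`, with respect to the iterates of `τ` at `0`. -/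
noncomputable def shiftOps (k : ℕ) (τ : Fin (n + 1) → Fin (n + 1)) :
    Finset (Fin (n + 1) → Fin (n + 1) → Fin (n + 1)) :=
  {f | (shiftGenerators τ).card ≤ k + 1 ∧ (∀ x y, f x y = f y x) ∧
    (∀ x y, f (τ x) y = τ (f x y)) ∧
    ∀ x y, (τ^[shiftFloor τ x + shiftFloor τ y] 0 : ℕ) ≤ f x y ∧
      (f x y : ℕ) ≤ (τ^[shiftFloor τ x + shiftFloor τ y] 0 : ℕ) + (k + 2)}

/-- Every point arises from a generator by iterating `τ`, so compatibility with `τ` propagates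
equality in one argument, and commutativity carries it to the other. -/
theorem eq_of_eqOn_shiftGenerators {k : ℕ} {τ : Fin (n + 1) → Fin (n + 1)}
    {f g : Fin (n + 1) → Fin (n + 1) → Fin (n + 1)} (hf : f ∈ shiftOps k τ)
    (hg : g ∈ shiftOps k τ)
    (h : ∀ x ∈ shiftGenerators τ, ∀ y ∈ shiftGenerators τ, f x y = g x y) : f = g := by
  obtain ⟨-, hfc, hfτ, -⟩ := (Finset.mem_filter.1 hf).2
  obtain ⟨-, hgc, hgτ, -⟩ := (Finset.mem_filter.1 hg).2
  have step : ∀ P : Fin (n + 1) → Prop, (∀ x ∈ shiftGenerators τ, P x) →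
      (∀ x, P x → P (τ x)) → ∀ x, P x := by
    intro P h0 h1 x
    induction x using WellFoundedLT.induction with
    | ind x ih =>
      by_cases hx : x ∈ shiftGenerators τ
      · exact h0 x hx
      · simp only [shiftGenerators, Finset.mem_filter, Finset.mem_univ, true_and, not_forall,
          not_not] at hx
        obtain ⟨y, hy, rfl⟩ := hx
        exact h1 y (ih y hy)
  have key : ∀ x ∈ shiftGenerators τ, ∀ y, f x y = g x y := fun x hx =>
    step _ (h x hx) fun y hy => by rw [hfc, hfτ, hgc x, hgτ, hfc, hgc y, hy]
  funext x
  exact step (fun x => f x = g x) (fun x hx => funext (key x hx))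
    (fun x hx => funext fun y => by rw [hfτ, hgτ, hx]) x

theorem card_shiftOps_le (k : ℕ) (τ : Fin (n + 1) → Fin (n + 1)) :
    (shiftOps k τ).card ≤ (k + 3) ^ ((k + 1) * (k + 1)) := by
  classical
  rcases (shiftOps k τ).eq_empty_or_nonempty with h | ⟨f, hf⟩
  · simp [h]
  have hG := (Finset.mem_filter.1 hf).2.1
  set G := shiftGenerators τ ×ˢ shiftGenerators τ with hGdef
  have hGcard : G.card ≤ (k + 1) * (k + 1) := by
    rw [hGdef, Finset.card_product]
    exact Nat.mul_le_mul hG hG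
  -- Off `G` the restricted operation is set to `0`, so those coordinates contribute a factor of
  -- one.
  set W : Fin (n + 1) × Fin (n + 1) → Finset (Fin (n + 1)) := fun p =>
    if p ∈ G then Finset.univ.filter fun z : Fin (n + 1) =>
      (τ^[shiftFloor τ p.1 + shiftFloor τ p.2] 0 : ℕ) ≤ z ∧
        (z : ℕ) ≤ (τ^[shiftFloor τ p.1 + shiftFloor τ p.2] 0 : ℕ) + (k + 2) else {0} with hW
  have hWcard : (Fintype.piFinset W).card ≤ (k + 3) ^ G.card := by
    refine card_piFinset_le_pow _ G _ (fun p hp => ?_) fun p hp => ?_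
    · rw [hW]
      simp only [hp, if_true]
      exact card_filter_window_le _ (k + 2) _ fun y hy => (Finset.mem_filter.1 hy).2
    · simp [hW, hp]
  refine le_trans ?_ (hWcard.trans (Nat.pow_le_pow_right (by omega) hGcard))
  refine Finset.card_le_card_of_injOn
    (fun f p => if p ∈ G then f p.1 p.2 else 0) (fun f hf => ?_) fun f hf g hg hfg => ?_
  · refine Finset.mem_coe.2 (Fintype.mem_piFinset.2 fun p => ?_)
    by_cases hp : p ∈ G
    · simp only [hW, hp, if_true, Finset.mem_filter, Finset.mem_univ, true_and]
      exact (Finset.mem_filter.1 (Finset.mem_coe.1 hf)).2.2.2.2 p.1 p.2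
    · simp [hW, hp]
  · refine eq_of_eqOn_shiftGenerators hf hg fun x hx y hy => ?_
    have hp : (x, y) ∈ G := Finset.mk_mem_product hx hy
    have := congrFun hfg (x, y)
    simpa [hp] using this

open Classical in
/-- The candidates for the additions, on `Fin (n + 1)`, of the distance monoids with `n` non-zero
elements and Archimedean complexity `n - k`. -/
noncomputable def candidateOps (n k : ℕ) : Finset (Fin (n + 1) → Fin (n + 1) → Fin (n + 1)) :=
  (Finset.powersetCard k Finset.univ).biUnion fun E => (shiftMaps k E).biUnion (shiftOps k)

theorem card_candidateOps_le (n k : ℕ) :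
    (candidateOps n k).card ≤
      (n + 1) ^ k * ((k + 3) ^ (2 * k + 1) * (k + 3) ^ ((k + 1) * (k + 1))) := by
  classical
  refine (Finset.card_biUnion_le_card_mul _ _ _ fun E hE =>
    (Finset.card_biUnion_le_card_mul _ _ _ fun τ _ => card_shiftOps_le k τ).trans
      (Nat.mul_le_mul_right _ (card_shiftMaps_le (Finset.mem_powersetCard.1 hE).2))).trans
    (Nat.mul_le_mul_right _ ?_)
  rw [Finset.card_powersetCard, Finset.card_univ, Fintype.card_fin]
  exact Nat.choose_le_pow _ _

end Counting

/-! ### Transporting addition to `Fin (n + 1)`. -/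

namespace DistanceMonoid

variable {R : Type*} [DistanceMonoid R] {a : R} {k M n : ℕ}

theorem orderIso_zero (e : R ≃o Fin (n + 1)) : e 0 = 0 :=
  le_antisymm (e.le_symm_apply.1 (zero_le' _)) (Fin.zero_le _)

theorem iterate_shift (e : R ≃o Fin (n + 1)) (i : ℕ) :
    (fun x => e (e.symm x + a))^[i] 0 = e (i • a) := by
  induction i with
  | zero => simp [orderIso_zero]
  | succ i ih => rw [Function.iterate_succ_apply', ih, e.symm_apply_apply, succ_nsmul]

variable [Fintype R]

theorem card_compl_multiples (hcard : Fintype.card R = M + 2 + k) (h : M • a + a ≠ M • a) :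
    ((Finset.range (M + 2)).image fun j => j • a)ᶜ.card = k := by
  have := card_compl_image_sum_range (b := fun _ => a) hcard (fun _ => le_rfl) (by simpa using h)
  simpa using this

/-- Such an interval contains at most the `k` non-multiples and `d` multiples of `a`. If `M + 1 ≤
i`, nothing above `i • a` is among the first `M + 2` multiples, so `y` needs no bound. -/
theorem card_Ioc_nsmul_le (hcard : Fintype.card R = M + 2 + k) (h : M • a + a ≠ M • a)
    {i d : ℕ} {y : R} (hy : y ≤ (i + d) • a ∨ M + 1 ≤ i) :
    (Finset.univ.filter fun x => i • a < x ∧ x ≤ y).card ≤ k + d := by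
  have hsub : (Finset.univ.filter fun x => i • a < x ∧ x ≤ y) ⊆
      ((Finset.range (M + 2)).image fun j => j • a)ᶜ ∪
        (Finset.Ioc i (i + d)).image fun j => j • a := by
    intro x hx
    obtain ⟨hx1, hx2⟩ := (Finset.mem_filter.1 hx).2
    rw [Finset.mem_union, or_iff_not_imp_left, Finset.mem_compl, not_not]
    intro hxT
    obtain ⟨l, hl, rfl⟩ := Finset.mem_image.1 hxT
    rw [Finset.mem_range] at hl
    have hil : i < l := by
      by_contra! hli
      exact (nsmul_mono a hli).not_gt hx1
    rcases hy with hy | hy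
    · rcases le_or_gt l (i + d) with hld | hld
      · exact Finset.mem_image.2 ⟨l, Finset.mem_Ioc.2 ⟨hil, hld⟩, rfl⟩
      -- Here the multiples have stabilised by `i + d`, so `l` may be replaced by `i + d`, unless `d
      -- = 0`, when the interval is empty.
      · have heq : (i + d) • a = l • a := le_antisymm (nsmul_mono a hld.le) (hx2.trans hy)
        rcases Nat.eq_zero_or_pos d with rfl | hd
        · exact absurd heq hx1.ne
        · exact Finset.mem_image.2 ⟨i + d, Finset.mem_Ioc.2 ⟨by omega, le_rfl⟩, heq⟩
    · omega
  refine (Finset.card_le_card hsub).trans ((Finset.card_union_le _ _).trans ?_)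
  rw [card_compl_multiples hcard h]
  exact Nat.add_le_add_left (Finset.card_image_le.trans (by simp)) _

theorem val_le_val_add_card (e : R ≃o Fin n) (x y : R) :
    (e y : ℕ) ≤ e x + (Finset.univ.filter fun z => x < z ∧ z ≤ y).card := by
  have hsub : Finset.Ioc (e x) (e y) ⊆
      (Finset.univ.filter fun z => x < z ∧ z ≤ y).image e := by
    intro z hz
    obtain ⟨h1, h2⟩ := Finset.mem_Ioc.1 hz
    refine Finset.mem_image.2 ⟨e.symm z, Finset.mem_filter.2 ⟨Finset.mem_univ _, ?_, ?_⟩, by simp⟩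
    · exact e.lt_symm_apply.2 h1
    · exact e.symm_apply_le.2 h2
  have := (Finset.card_le_card hsub).trans Finset.card_image_le
  rw [Fin.card_Ioc] at this
  omega

variable (e : R ≃o Fin (n + 1))

/-- The search for the floor stops at `n ≥ M + 1`, so if the next multiple does not exceed the
point, the cap was reached and the second alternative holds. -/
theorem shiftFloor_spec (hcard : Fintype.card R = M + 2 + k) (x : Fin (n + 1)) :
    shiftFloor (fun x => e (e.symm x + a)) x • a ≤ e.symm x ∧
      (e.symm x ≤ (shiftFloor (fun x => e (e.symm x + a)) x + 1) • a ∨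
        M + 1 ≤ shiftFloor (fun x => e (e.symm x + a)) x) := by
  have hn : M + 2 + k = n + 1 := by
    rw [← hcard, Fintype.card_congr e.toEquiv, Fintype.card_fin]
  constructor
  · have := Nat.findGreatest_spec (P := fun i => (fun x => e (e.symm x + a))^[i] 0 ≤ x)
      (Nat.zero_le n) (Fin.zero_le _)
    simp only [iterate_shift] at this
    rw [e.le_symm_apply, shiftFloor]
    simpa only [iterate_shift] using this
  · rw [or_iff_not_imp_right, not_le]
    intro hlt
    have := Nat.findGreatest_is_greatest (P := fun i => (fun x => e (e.symm x + a))^[i] 0 ≤ x)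
      (Nat.lt_succ_self (shiftFloor (fun x => e (e.symm x + a)) x))
      (by change shiftFloor (fun x => e (e.symm x + a)) x + 1 ≤ n; omega)
    rw [iterate_shift, ← e.le_symm_apply, not_le] at this
    exact this.le

theorem shift_mem_shiftMaps (hcard : Fintype.card R = M + 2 + k) (h : M • a + a ≠ M • a) :
    (fun x => e (e.symm x + a)) ∈ shiftMaps k
      ((((Finset.range (M + 2)).image fun j => j • a)ᶜ).map e.toEquiv.toEmbedding) := by
  refine Fintype.mem_piFinset.2 fun x => Finset.mem_filter.2 ⟨Finset.mem_univ _, ?_, ?_, ?_⟩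
  · exact e.symm_apply_le.1 (DistanceMonoid.le_add _ _)
  · obtain ⟨h1, h2⟩ := shiftFloor_spec (a := a) e hcard x
    set i := shiftFloor (fun x => e (e.symm x + a)) x
    -- From `x ≤ (i + 1) • a` follows `x + a ≤ (i + 2) • a`: this is the `2` in the displacement
    -- bound `k + 2`.
    have h3 := card_Ioc_nsmul_le (y := e.symm x + a) (d := 2) hcard h
      (h2.imp_left fun h2 => (add_le_add h2 le_rfl).trans_eq
        (by rw [← succ_nsmul]))
    have h4 := val_le_val_add_card e (i • a) (e.symm x + a)
    have h5 : e (i • a) ≤ x := e.le_symm_apply.1 h1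
    have h6 : (e (i • a) : ℕ) ≤ x := h5
    omega
  · intro hx hxn hE
    have key : ∀ z : Fin (n + 1),
        z ∉ (((Finset.range (M + 2)).image fun j => j • a)ᶜ).map e.toEquiv.toEmbedding →
          ∃ j ≤ M + 1, e (j • a) = z := by
      intro z hz
      by_contra! hne
      refine hz (Finset.mem_map.2 ⟨e.symm z, ?_, by simp⟩)
      simp only [Finset.mem_compl, Finset.mem_image, Finset.mem_range, not_exists, not_and]
      intro j hj hjz
      exact hne j (by omega) (by rw [hjz, e.apply_symm_apply])
    obtain ⟨j, hj, rfl⟩ := key x hx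
    obtain ⟨l, hl, hlz⟩ := key ⟨e (j • a) + 1, by omega⟩ fun hz => hE _ hz rfl
    have hjl : e (j • a) < e (l • a) := by
      rw [hlz, Fin.lt_def]
      exact Nat.lt_succ_self _
    have hjl' : j < l := by
      by_contra! hlj
      exact (e.monotone (nsmul_mono a hlj)).not_gt hjl
    -- `(j + 1) • a` is strictly above position `x` and at most at position `x + 1`, hence exactly
    -- there.
    have h1 : e (j • a) < e ((j + 1) • a) :=
      e.strictMono (nsmul_lt_nsmul_of_add_ne h (by omega) (Nat.lt_succ_self j))
    have h2 : e ((j + 1) • a) ≤ e (l • a) := e.monotone (nsmul_mono a hjl')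
    rw [hlz, Fin.le_def] at h2
    rw [Fin.lt_def] at h1
    rw [e.symm_apply_apply, ← succ_nsmul]
    exact le_antisymm h2 h1

/-- Each of the first `M + 2` multiples other than `0` is the translate of the strictly smaller
preceding one, so only `0` and the `k` exceptional elements can be generators. -/
theorem card_shiftGenerators_le (hcard : Fintype.card R = M + 2 + k) (h : M • a + a ≠ M • a) :
    (shiftGenerators (fun x => e (e.symm x + a))).card ≤ k + 1 := by
  have hsub : shiftGenerators (fun x => e (e.symm x + a)) ⊆
      insert 0 ((((Finset.range (M + 2)).image fun j => j • a)ᶜ).map e.toEquiv.toEmbedding) := by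
    intro x hx
    replace hx := (Finset.mem_filter.1 hx).2
    by_contra hne
    rw [Finset.mem_insert, not_or] at hne
    refine hne.2 (Finset.mem_map.2 ⟨e.symm x, ?_, by simp⟩)
    simp only [Finset.mem_compl, Finset.mem_image, Finset.mem_range, not_exists, not_and]
    intro j hj hjx
    obtain rfl : e (j • a) = x := by rw [hjx, e.apply_symm_apply]
    rcases j with _ | j
    · exact hne.1 (by rw [zero_nsmul, orderIso_zero])
    · refine hx (e (j • a))
        (e.strictMono (nsmul_lt_nsmul_of_add_ne h (by omega) (Nat.lt_succ_self j))) ?_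
      beta_reduce
      rw [e.symm_apply_apply, succ_nsmul]
  refine (Finset.card_le_card hsub).trans ((Finset.card_insert_le _ _).trans ?_)
  rw [Finset.card_map, card_compl_multiples hcard h]

theorem add_mem_shiftOps (hcard : Fintype.card R = M + 2 + k) (h : M • a + a ≠ M • a) :
    (fun x y => e (e.symm x + e.symm y)) ∈ shiftOps k (fun x => e (e.symm x + a)) := by
  refine Finset.mem_filter.2 ⟨Finset.mem_univ _, card_shiftGenerators_le e hcard h,
    fun x y => congrArg e (add_comm _ _), fun x y => ?_, fun x y => ?_⟩
  · simp only [e.symm_apply_apply]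
    rw [add_right_comm]
  · obtain ⟨h1, h2⟩ := shiftFloor_spec (a := a) e hcard x
    obtain ⟨h3, h4⟩ := shiftFloor_spec (a := a) e hcard y
    rw [iterate_shift]
    set i := shiftFloor (fun x => e (e.symm x + a)) x
    set j := shiftFloor (fun x => e (e.symm x + a)) y
    constructor
    · have : e ((i + j) • a) ≤ e (e.symm x + e.symm y) :=
        e.monotone ((add_nsmul a i j).trans_le (add_le_add h1 h3))
      exact this
    · have h5 := card_Ioc_nsmul_le (y := e.symm x + e.symm y) (i := i + j) (d := 2) hcard h (by
        rcases h2 with h2 | h2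
        · rcases h4 with h4 | h4
          · left
            refine (add_le_add h2 h4).trans_eq ?_
            rw [← add_nsmul]
            congr 1
            omega
          · right
            omega
        · right
          omega)
      have h6 := val_le_val_add_card e ((i + j) • a) (e.symm x + e.symm y)
      exact h6.trans (by omega)

theorem add_mem_candidateOps (hcard : Fintype.card R = M + 2 + k)
    (hM : (k + 1) * (k + 1) ≤ M + 1) (h : ¬ ArchBoundedBy R M) :
    (fun x y => e (e.symm x + e.symm y)) ∈ candidateOps n k := by
  obtain ⟨a, ha⟩ := exists_nsmul_add_ne hcard hM h
  refine Finset.mem_biUnion.2 ⟨_, ?_, Finset.mem_biUnion.2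
    ⟨_, shift_mem_shiftMaps e hcard ha, add_mem_shiftOps e hcard ha⟩⟩
  rw [Finset.mem_powersetCard, Finset.card_map]
  exact ⟨Finset.subset_univ _, card_compl_multiples hcard ha⟩

end DistanceMonoid

/-! ### From operations to isomorphism classes. -/

namespace FiniteDistanceMonoid

theorem natCard_carrier {n m : ℕ} (A : FiniteDistanceMonoid n m) :
    Nat.card A.carrier = n + 1 := by
  have h := Set.encard_add_encard_compl ({0} : Set A.carrier)
  have h0 : ({0} : Set A.carrier)ᶜ = {r | r ≠ 0} := by
    ext
    simp
  rw [h0, A.encard_nonzero, Set.encard_singleton, Set.encard_univ] at h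
  have h1 : ENat.card A.carrier = (n + 1 : ℕ) := by
    rw [← h]
    push_cast
    rw [add_comm]
  have : Finite A.carrier := ENat.card_lt_top.1 (h1 ▸ ENat.natCast_lt_top _)
  rw [ENat.card_eq_coe_natCard] at h1
  exact_mod_cast h1

theorem exists_orderIso {n m : ℕ} (A : FiniteDistanceMonoid n m) :
    Nonempty (A.carrier ≃o Fin (n + 1)) := by
  have : Finite A.carrier := Nat.finite_of_card_ne_zero (by rw [natCard_carrier]; omega)
  have := Fintype.ofFinite A.carrier
  exact ⟨(Fintype.orderIsoFinOfCardEq A.carrier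
    (by rw [← Nat.card_eq_fintype_card, natCard_carrier])).symm⟩

theorem not_archBoundedBy {n m : ℕ} (A : FiniteDistanceMonoid n (m + 1)) :
    ¬ ArchBoundedBy A.carrier m := by
  intro h
  have h1 : arch A.carrier ≤ m := sInf_le ⟨m, rfl, h⟩
  rw [A.arch_eq] at h1
  have : m + 1 ≤ m := by exact_mod_cast h1
  omega

/-- The addition of a finite distance monoid, transported to an initial segment of `ℕ`. -/
noncomputable def op {n m : ℕ} (A : FiniteDistanceMonoid n m) :
    Fin (n + 1) → Fin (n + 1) → Fin (n + 1) := fun x y =>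
  A.exists_orderIso.some (A.exists_orderIso.some.symm x + A.exists_orderIso.some.symm y)

theorem equiv_of_op_eq {n m : ℕ} {A B : FiniteDistanceMonoid n m} (h : A.op = B.op) :
    Nonempty (A.carrier ≃+o B.carrier) := by
  set e := A.exists_orderIso.some with he
  set f := B.exists_orderIso.some with hf
  refine ⟨{ (e.trans f.symm) with
    map_add' := fun x y => ?_
    map_le_map_iff' := (e.trans f.symm).map_rel_iff }⟩
  have h1 := congrFun (congrFun h (e x)) (e y)
  simp only [op, ← he, ← hf, e.symm_apply_apply] at h1
  change f.symm (e (x + y)) = f.symm (e x) + f.symm (e y)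
  rw [h1, f.symm_apply_apply]

theorem op_mem_candidateOps {m k : ℕ} (hm : (k + 1) * (k + 1) ≤ m)
    (A : FiniteDistanceMonoid (m + k) m) : A.op ∈ candidateOps (m + k) k := by
  obtain ⟨M, rfl⟩ : ∃ M, m = M + 1 := ⟨m - 1, by
    have : 0 < (k + 1) * (k + 1) := by positivity
    omega⟩
  have : Finite A.carrier := Nat.finite_of_card_ne_zero (by rw [natCard_carrier]; omega)
  have := Fintype.ofFinite A.carrier
  refine DistanceMonoid.add_mem_candidateOps _ ?_ hm A.not_archBoundedBy
  rw [← Nat.card_eq_fintype_card, natCard_carrier]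
  omega

/-- The class of a finite distance monoid is determined by its transported addition. -/
theorem injective_op {m k : ℕ} (hm : (k + 1) * (k + 1) ≤ m) :
    Function.Injective fun q : Quotient (isoSetoid (m + k) m) =>
      (⟨q.out.op, op_mem_candidateOps hm q.out⟩ : candidateOps (m + k) k) := by
  intro p q h
  rw [← p.out_eq, ← q.out_eq]
  exact Quotient.sound (equiv_of_op_eq (Subtype.ext_iff.1 h))

end FiniteDistanceMonoid

theorem finite_quotient {m k : ℕ} (hm : (k + 1) * (k + 1) ≤ m) :
    Finite (Quotient (FiniteDistanceMonoid.isoSetoid (m + k) m)) :=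
  Finite.of_injective _ (FiniteDistanceMonoid.injective_op hm)

theorem DM_le {m k : ℕ} (hm : (k + 1) * (k + 1) ≤ m) :
    DM (m + k) m ≤
      (m + k + 1) ^ k * ((k + 3) ^ (2 * k + 1) * (k + 3) ^ ((k + 1) * (k + 1))) := by
  have := Nat.card_le_card_of_injective _ (FiniteDistanceMonoid.injective_op hm)
  rw [Nat.card_eq_fintype_card (α := candidateOps _ _), Fintype.card_coe] at this
  exact this.trans (card_candidateOps_le _ _)

theorem mainTheorem6 (k : ℕ) :
    ∃ C₁ C₂ : ℝ, 0 < C₁ ∧ 0 < C₂ ∧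
      ∀ᶠ n : ℕ in Filter.atTop,
        C₁ ≤ (DM n (n - k) : ℝ) / (n : ℝ) ^ k ∧ (DM n (n - k) : ℝ) / (n : ℝ) ^ k ≤ C₂ := by
  refine ⟨1 / (2 ^ k * k.factorial),
    2 ^ k * ((k + 3) ^ (2 * k + 1) * (k + 3) ^ ((k + 1) * (k + 1))),
    by positivity, by positivity, ?_⟩
  -- With `n = m + k` this threshold yields `(k + 1) ^ 2 ≤ m`, for the structure theorem, and `3 * k
  -- + 1 ≤ m`, which gives `m + k ≤ 2 * (m - k)`.
  filter_upwards [Filter.eventually_ge_atTop ((k + 1) * (k + 1) + 4 * k + 1)] with n hn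
  obtain ⟨m, rfl⟩ : ∃ m, n = m + k := ⟨n - k, by omega⟩
  have hm : (k + 1) * (k + 1) ≤ m := by omega
  have hmk : 3 * k + 1 ≤ m := by omega
  have := finite_quotient hm
  rw [Nat.add_sub_cancel]
  have hpos : (0 : ℝ) < ((m + k : ℕ) : ℝ) ^ k := by
    have : (0 : ℝ) < ((m + k : ℕ) : ℝ) := by
      have : 0 < m + k := by omega
      exact_mod_cast this
    positivity
  constructor
  · rw [le_div_iff₀ hpos, one_div_mul_eq_div, div_le_iff₀ (by positivity)]
    have h1 : (m - k) ^ k ≤ (m - 1).descFactorial k := by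
      have := Nat.pow_sub_le_descFactorial (m - 1) k
      rwa [show m - 1 + 1 - k = m - k by omega] at this
    rw [Nat.descFactorial_eq_factorial_mul_choose] at h1
    have h2 : (m + k) ^ k ≤ 2 ^ k * (m - k) ^ k := by
      rw [← mul_pow]
      exact Nat.pow_le_pow_left (by omega) k
    have h3 : (m + k) ^ k ≤ DM (m + k) m * (2 ^ k * k.factorial) :=
      calc (m + k) ^ k ≤ 2 ^ k * (k.factorial * (m - 1).choose k) :=
            h2.trans (Nat.mul_le_mul_left _ h1)
        _ ≤ 2 ^ k * (k.factorial * DM (m + k) m) := by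
            gcongr
            exact choose_le_DM k m (by omega)
        _ = _ := by ring
    exact_mod_cast h3
  · rw [div_le_iff₀ hpos]
    have h1 : DM (m + k) m ≤
        2 ^ k * ((k + 3) ^ (2 * k + 1) * (k + 3) ^ ((k + 1) * (k + 1))) * (m + k) ^ k :=
      calc _ ≤ _ := DM_le hm
        _ ≤ (2 * (m + k)) ^ k * ((k + 3) ^ (2 * k + 1) * (k + 3) ^ ((k + 1) * (k + 1))) := by
            gcongr
            omega
        _ = _ := by
            rw [mul_pow]
            ring
    exact_mod_cast h1
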